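/- Let $G=(V,E)$ be a finite directed graph. For each $v\in V$ let $A_v$ and $Q_v$ be finite sets, and put $A=\bigsqcup_{v\in V}A_v$ and $Q=\prod_{v\in V}Q_v$. Let $\mathcal N$ be an abelian network on $G$ with alphabet $A$ and state space $Q$: each vertex $v$ carries commuting maps $t_a:Q_v\to Q_v$ $(a\in A_v)$ and functions $o_a^u:Q_v\to A_u^*$ $(a\in A_v,\ (v,u)\in E)$ such that, for every initial state and every $u$, two input words in $A_v^*$ that are equal up to permutation produce output words in $A_u^*$ that are equal up to permutation. Processing a letter $a\in A_v$ in a configuration $\mathbf y.\mathbf q\in\mathbb Z^A\times Q$ lowers $\mathbf y_a$ by one, adds to $\mathbf y$ the letters of the words $o_a^u(\mathbf q_v)$ for all $(v,u)\in E$, and replaces $\mathbf q_v$ by $t_a(\mathbf q_v)$. For $w\in A^*$ let $|w|\in\mathbb N^A$ count its letters. The configuration $\pi_w(\mathbf y.\mathbf q)$ obtained by processing the letters of $w$ in order depends only on $|w|$, and is also written $\pi_{|w|}(\mathbf y.\mathbf q)$. The word $w$ is \emph{legal} for $\mathbf y.\mathbf q$ if each of its letters $a$ is processed at a moment when the current $a$-coordinate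 is at least $1$, and \emph{complete} if no coordinate is positive after $w$ is processed. Assume that $\mathcal N$ \emph{halts on all inputs}, i.e. for all $\mathbf x\in\mathbb N^A$ and $\mathbf q\in Q$ there is a complete legal word $w$ for $\mathbf x.\mathbf q$. The \emph{odometer} is $[\mathbf x.\mathbf q]:=|w|\in\mathbb N^A$, and $\mathbf x\triangleright\!\triangleright\mathbf q\in Q$ denotes the final state; both are independent of the choice of $w$. Assume also that $\mathcal N$ is \emph{irreducible}, i.e. for every $v$, writing $M_v$ for the monoid of self-maps of $Q_v$ generated by $(t_a)_{a\in A_v}$, we have $Q_v\ne\emptyset$ and for all $q,q'\in Q_v$ there are $m,m'\in M_v$ with $mq=m'q'$. If a monoid $M$ acts on a set $X$, call $x\in X$ recurrent if $x\in M(mx)$ for all $m\in M$. Let $\mathrm{Rec}\,\mathcal N$ be the set of states in $Q$ that are recurrent for the monoid generated by the maps $\tau_a:\mathbf q\mapsto 1_a\triangleright\!\triangleright\mathbf q$ $(a\in A)$. Call $\mathbf q\in Q$ locally recurrent if each $\mathbf q_v$ is recurrent for $M_v$. The maps $t_a$ $(a\in A_v)$ permute the recurrent elements of $Q_v$; let $K_v\subseteq\mathbb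 Z^{A_v}$ be the kernel of the resulting action of $\mathbb Z^{A_v}$ on these elements, and let $K=\prod_{v}K_v\subseteq\mathbb Z^A$. For a locally recurrent state $\mathbf q_0$ and $\mathbf k\in K\cap\mathbb N^A$ we have $\pi_{\mathbf k}(\mathbf k.\mathbf q_0)=P_{\mathbf q_0}(\mathbf k).\mathbf q_0$ for a vector $P_{\mathbf q_0}(\mathbf k)\in\mathbb N^A$. Let $P$ be the $A\times A$ rational matrix of the linear extension of $P_{\mathbf q_0}$ to $\mathbb Q^A$; that is, column $b$ of $P$ is $P_{\mathbf q_0}(r_b1_b)/r_b$ with $r_b=\min\{m\ge1: m1_b\in K\}$. Then $\mathrm{Rec}\,\mathcal N$ is nonempty, locally recurrent states exist, and, for every choice of the locally recurrent state $\mathbf q_0$, the matrix $I-P$ is invertible and, if $\mathbf q$ is a uniformly random element of $\mathrm{Rec}\,\mathcal N$, $$\mathbb E\,[\mathbf x.\mathbf q]=(I-P)^{-1}\mathbf x\qquad\text{for all }\mathbf x\in\mathbb N^A.$$ -/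

import Mathlib

/-! ### Monoid actions -/

/-- An action is irreducible if the relation `x ∼ x'`, i.e. `m x = m' x'` for some `m, m'`, has
exactly one equivalence class. -/
def IsIrreducibleAction (M X : Type*) [Monoid M] [MulAction M X] : Prop :=
  Nonempty X ∧ ∀ x x' : X, ∃ m m' : M, m • x = m' • x'

/-- Recurrent elements: `x ∈ M (m x)` for every `m`. For a finite commutative monoid with minimal
idempotent `e` this says `x = e x`, equivalently `x ∈ e X`. -/
def IsRecurrentElt (M : Type*) {X : Type*} [Monoid M] [MulAction M X] (x : X) : Prop :=
  ∀ m : M, ∃ m' : M, m' • m • x = x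

/-- A monoid acting on a nonempty finite set has a recurrent element. -/
theorem exists_isRecurrentElt (M X : Type*) [Monoid M] [MulAction M X] [Finite X] [Nonempty X] :
    ∃ x : X, IsRecurrentElt M x := by
  obtain ⟨x, hx⟩ := Finite.exists_min (fun x : X => (MulAction.orbit M x).ncard)
  refine ⟨x, fun m => ?_⟩
  have hsub : MulAction.orbit M (m • x) ⊆ MulAction.orbit M x := by
    rintro _ ⟨n, rfl⟩
    exact ⟨n * m, mul_smul n m x⟩
  have heq := Set.eq_of_subset_of_ncard_le hsub (hx (m • x)) (Set.toFinite _)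
  have hmem : x ∈ MulAction.orbit M (m • x) := heq ▸ ⟨1, one_smul M x⟩
  exact hmem

/-! ### Abelian processors -/

/-- State reached from `q` after reading a word, given the transition maps `t`. -/
def runWord {I S : Type*} (t : I → S → S) : S → List I → S
  | q, [] => q
  | q, a :: w => runWord t (t a q) w

/-- Word emitted on an output feed with alphabet `B` while reading a word from state `q`. -/
def outWord {I S B : Type*} (t : I → S → S) (o : I → S → List B) : S → List I → List B
  | _, [] => []
  | q, a :: w => o a q ++ outWord t o (t a q) w

/-- An abelian processor with input alphabet `I`, state space `S` and output alphabets
`(B u)_{u : U}`. -/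
structure AbelianProcessor (I S : Type*) {U : Type*} (B : U → Type*) where
  /-- state transition maps -/
  t : I → Function.End S
  /-- message passing functions -/
  o : I → (u : U) → S → List (B u)
  /-- the transition maps commute -/
  t_comm : ∀ a b : I, t a * t b = t b * t a
  /-- input words equal up to permutation yield output words equal up to permutation -/
  o_perm : ∀ (q : S) (w w' : List I), w.Perm w' → ∀ u : U,
    (outWord t (fun a => o a u) q w).Perm (outWord t (fun a => o a u) q w')

namespace AbelianProcessor

/-- The transition monoid, generated by the transition maps. -/
def transitionMonoid {I S U : Type*} {B : U → Type*} (p : AbelianProcessor I S B) :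
    Submonoid (Function.End S) :=
  Submonoid.closure (Set.range p.t)

/-- The processor is irreducible if the action of its transition monoid is. -/
def Irreducible {I S U : Type*} {B : U → Type*} (p : AbelianProcessor I S B) : Prop :=
  IsIrreducibleAction p.transitionMonoid S

/-- The kernel of the action of `ℤ^I` on the recurrent states of the processor. Letters act on
these states by commuting permutations, so an integer vector `k = |w| - |w'|` acts as the
transformation of the word `w` followed by the inverse of the one of `w'`, and it acts trivially
when `w` and `w'` act in the same way. -/
def kernel {I S U : Type*} [DecidableEq I] {B : U → Type*} (p : AbelianProcessor I S B) :
    Set (I → ℤ) :=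
  {k | ∀ w w' : List I, (∀ a, k a = (w.count a : ℤ) - (w'.count a : ℤ)) →
    ∀ q : S, IsRecurrentElt p.transitionMonoid q → runWord p.t q w = runWord p.t q w'}

end AbelianProcessor

/-! ### Abelian networks -/

/-- An abelian network on the directed graph `G` with alphabets `A v` and state spaces `Q v`: an
abelian processor at each vertex `v`, with an output feed for each edge `(v, u)`, of alphabet
`A u`. The total alphabet is `Σ v, A v` and the total state space is `∀ v, Q v`. -/
structure AbelianNetwork {V : Type*} (G : Digraph V) (A Q : V → Type*) where
  /-- the processor at each vertex -/
  proc : ∀ v : V, AbelianProcessor (A v) (Q v) (fun u : {u : V // G.Adj v u} => A u.1)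

namespace AbelianNetwork

/-- The pairs `x.q`: letters waiting to be processed (negative entries are debts) and states. -/
abbrev Config {V : Type*} (A Q : V → Type*) : Type _ := ((Σ v, A v) → ℤ) × (∀ v, Q v)

/-- The vector counting the letters of a word. -/
def wordVec {V : Type*} {A : V → Type*} [DecidableEq V] [∀ v, DecidableEq (A v)]
    (w : List (Σ v, A v)) : (Σ v, A v) → ℕ :=
  fun a => w.count a

/-- A word with a prescribed number of occurrences of each letter. -/
noncomputable def vecWord {V : Type*} {A : V → Type*} [Fintype V] [∀ v, Fintype (A v)]
    (x : (Σ v, A v) → ℕ) : List (Σ v, A v) :=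
  (∑ a, x a • ({a} : Multiset (Σ v, A v))).toList

section

variable {V : Type*} {G : Digraph V} {A Q : V → Type*} [DecidableEq V] [∀ v, DecidableEq (A v)]

open Classical in
/-- The number of letters of each type passed when letter `a` is processed in state `q`. -/
noncomputable def message (N : AbelianNetwork G A Q) (a : Σ v, A v) (q : ∀ v, Q v) :
    (Σ v, A v) → ℕ :=
  fun b => if h : G.Adj a.1 b.1 then ((N.proc a.1).o a.2 ⟨b.1, h⟩ (q a.1)).count b.2 else 0

/-- Processing one letter `a` (whether or not such a letter is present). -/
noncomputable def step (N : AbelianNetwork G A Q) (a : Σ v, A v) (c : Config A Q) : Config A Q :=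
  (fun b => c.1 b - (if b = a then 1 else 0) + (N.message a c.2 b : ℤ),
    Function.update c.2 a.1 ((N.proc a.1).t a.2 (c.2 a.1)))

/-- The result `π_w(x.q)` of executing the word `w`. -/
noncomputable def exec (N : AbelianNetwork G A Q) : List (Σ v, A v) → Config A Q → Config A Q
  | [], c => c
  | a :: w, c => exec N w (N.step a c)

/-- A word is legal if each letter is present when it is processed. -/
def Legal (N : AbelianNetwork G A Q) : List (Σ v, A v) → Config A Q → Prop
  | [], _ => True
  | a :: w, c => 1 ≤ c.1 a ∧ Legal N w (N.step a c)

/-- A word is complete if no letters remain after it has been executed. -/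
def Complete (N : AbelianNetwork G A Q) (w : List (Σ v, A v)) (c : Config A Q) : Prop :=
  ∀ a, (N.exec w c).1 a ≤ 0

theorem step_comm (N : AbelianNetwork G A Q) (a b : Σ v, A v) (c : Config A Q) :
    N.step a (N.step b c) = N.step b (N.step a c) := by
  obtain ⟨v, a⟩ := a
  obtain ⟨u, b⟩ := b
  by_cases h : v = u
  · subst h
    have ht : (N.proc v).t a ((N.proc v).t b (c.2 v)) = (N.proc v).t b ((N.proc v).t a (c.2 v)) :=
      congrFun ((N.proc v).t_comm a b) (c.2 v)
    refine Prod.ext (funext fun d => ?_) ?_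
    · have hp : N.message ⟨v, b⟩ c.2 d + N.message ⟨v, a⟩ (N.step ⟨v, b⟩ c).2 d =
          N.message ⟨v, a⟩ c.2 d + N.message ⟨v, b⟩ (N.step ⟨v, a⟩ c).2 d := by
        by_cases hd : G.Adj v d.1
        · have := ((N.proc v).o_perm (c.2 v) [b, a] [a, b] (List.Perm.swap a b [])
            ⟨d.1, hd⟩).count_eq d.2
          simpa [message, step, hd, outWord] using this
        · simp [message, hd]
      have hp' : (N.message ⟨v, b⟩ c.2 d : ℤ) + N.message ⟨v, a⟩ (N.step ⟨v, b⟩ c).2 d =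
          N.message ⟨v, a⟩ c.2 d + N.message ⟨v, b⟩ (N.step ⟨v, a⟩ c).2 d := by exact_mod_cast hp
      simp only [step] at hp' ⊢
      linarith
    · simp [step, ht]
  · refine Prod.ext (funext fun d => ?_) ?_
    · simp only [step, message, Function.update_of_ne h, Function.update_of_ne (Ne.symm h)]
      ring
    · simp only [step, Function.update_of_ne h, Function.update_of_ne (Ne.symm h)]
      exact (Function.update_comm h _ _ _).symm

/-- The result of an execution depends only on the number of letters of each type. -/
theorem exec_perm (N : AbelianNetwork G A Q) {w w' : List (Σ v, A v)} (h : w.Perm w')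
    (c : Config A Q) : N.exec w c = N.exec w' c := by
  induction h generalizing c with
  | nil => rfl
  | cons a _ ih => exact ih _
  | swap a b l => simp only [exec, step_comm N a b c]
  | trans _ _ ih₁ ih₂ => exact (ih₁ c).trans (ih₂ c)

theorem le_exec_of_notMem (N : AbelianNetwork G A Q) (a : Σ v, A v) (w : List (Σ v, A v))
    (hw : a ∉ w) (c : Config A Q) : c.1 a ≤ (N.exec w c).1 a := by
  induction w generalizing c with
  | nil => exact le_rfl
  | cons b w ih =>
    rw [List.mem_cons, not_or] at hw
    refine le_trans ?_ (ih hw.2 (N.step b c))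
    simp [step, hw.1]

/-- A legal execution is contained in every complete execution. -/
theorem leastAction (N : AbelianNetwork G A Q) (w w' : List (Σ v, A v)) (c : Config A Q)
    (hw : N.Legal w c) (hw' : N.Complete w' c) (a : Σ v, A v) : w.count a ≤ w'.count a := by
  induction w generalizing w' c with
  | nil => simp
  | cons b w ih =>
    have hb : b ∈ w' := by
      by_contra hb
      have h1 := N.le_exec_of_notMem b w' hb c
      have h2 := hw' b
      have h3 := hw.1
      omega
    have hperm := List.perm_cons_erase hb
    have hc : N.Complete (w'.erase b) (N.step b c) := fun d => by
      have := hw' d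
      rwa [N.exec_perm hperm c] at this
    have := ih (w'.erase b) (N.step b c) hw.2 hc
    rw [hperm.count_eq a, List.count_cons, List.count_cons]
    omega

/-- The configuration `x.q` for `x ∈ ℕ^A`. -/
def config (x : (Σ v, A v) → ℕ) (q : ∀ v, Q v) : Config A Q := (fun a => (x a : ℤ), q)

/-- The network halts on all inputs. -/
def HaltsOnAllInputs (N : AbelianNetwork G A Q) : Prop :=
  ∀ (x : (Σ v, A v) → ℕ) (q : ∀ v, Q v), ∃ w, N.Legal w (config x q) ∧ N.Complete w (config x q)

/-- The network is irreducible: every processor is. -/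
def Irreducible (N : AbelianNetwork G A Q) : Prop := ∀ v, (N.proc v).Irreducible

/-- A complete legal execution for `x.q`. -/
noncomputable def haltingWord (N : AbelianNetwork G A Q) (h : N.HaltsOnAllInputs)
    (x : (Σ v, A v) → ℕ) (q : ∀ v, Q v) : List (Σ v, A v) :=
  Classical.choose (h x q)

/-- The odometer `[x.q]`: the number of letters of each type in a complete legal execution. -/
noncomputable def odometer (N : AbelianNetwork G A Q) (h : N.HaltsOnAllInputs)
    (x : (Σ v, A v) → ℕ) (q : ∀ v, Q v) : (Σ v, A v) → ℕ :=
  wordVec (N.haltingWord h x q)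

/-- The final state `x ▷▷ q`. -/
noncomputable def finalState (N : AbelianNetwork G A Q) (h : N.HaltsOnAllInputs)
    (x : (Σ v, A v) → ℕ) (q : ∀ v, Q v) : ∀ v, Q v :=
  (N.exec (N.haltingWord h x q) (config x q)).2

/-- The odometer and the final state may be computed with any complete legal execution. -/
theorem odometer_finalState_eq (N : AbelianNetwork G A Q) (h : N.HaltsOnAllInputs)
    (x : (Σ v, A v) → ℕ) (q : ∀ v, Q v) (w : List (Σ v, A v)) (hl : N.Legal w (config x q))
    (hc : N.Complete w (config x q)) :
    N.odometer h x q = wordVec w ∧ N.finalState h x q = (N.exec w (config x q)).2 := by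
  have hs := Classical.choose_spec (h x q)
  have hcount : ∀ a, (N.haltingWord h x q).count a = w.count a := fun a =>
    le_antisymm (N.leastAction _ _ _ hs.1 hc a) (N.leastAction _ _ _ hl hs.2 a)
  refine ⟨funext hcount, ?_⟩
  rw [finalState, N.exec_perm (List.perm_iff_count.2 hcount)]

/-- The map `τ_a : q ↦ 1_a ▷▷ q`. -/
noncomputable def tau (N : AbelianNetwork G A Q) (h : N.HaltsOnAllInputs) (a : Σ v, A v) :
    Function.End (∀ v, Q v) :=
  fun q => N.finalState h (Pi.single a 1) q

/-- The global monoid, generated by the maps `τ_a`. -/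
noncomputable def globalMonoid (N : AbelianNetwork G A Q) (h : N.HaltsOnAllInputs) :
    Submonoid (Function.End (∀ v, Q v)) :=
  Submonoid.closure (Set.range (N.tau h))

/-- The set of recurrent states. -/
def Rec (N : AbelianNetwork G A Q) (h : N.HaltsOnAllInputs) : Set (∀ v, Q v) :=
  {q | IsRecurrentElt (N.globalMonoid h) q}

/-- Locally recurrent states: each coordinate is recurrent for the local monoid. -/
def LocallyRecurrent (N : AbelianNetwork G A Q) (q : ∀ v, Q v) : Prop :=
  ∀ v, IsRecurrentElt (N.proc v).transitionMonoid (q v)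

/-- The total kernel `K = ∏ K_v`, as a subset of `ℤ^A`. -/
def totalKernel (N : AbelianNetwork G A Q) : Set ((Σ v, A v) → ℤ) :=
  {k | ∀ v, (fun a : A v => k ⟨v, a⟩) ∈ (N.proc v).kernel}

/-- The reset number `r_a`: the least `m ≥ 1` such that `m 1_a` lies in the total kernel. -/
noncomputable def resetNumber (N : AbelianNetwork G A Q) (a : Σ v, A v) : ℕ :=
  sInf {m : ℕ | 1 ≤ m ∧ (Pi.single a (m : ℤ) : (Σ v, A v) → ℤ) ∈ N.totalKernel}

variable [Fintype V] [∀ v, Fintype (A v)]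

/-- The local action `x ▷ (y.q) = π_x((x + y).q)`. -/
noncomputable def localAction (N : AbelianNetwork G A Q) (x : (Σ v, A v) → ℕ) (c : Config A Q) :
    Config A Q :=
  N.exec (vecWord x) (fun a => (x a : ℤ) + c.1 a, c.2)

/-- The vector `P_q(k)`, where `k ▷ q = P_q(k).q` for `k ∈ K ∩ ℕ^A`. -/
noncomputable def production (N : AbelianNetwork G A Q) (q : ∀ v, Q v) (k : (Σ v, A v) → ℕ) :
    (Σ v, A v) → ℤ :=
  (N.localAction k (0, q)).1

/-- The production matrix: the matrix of the linear map on `ℚ^A` extending `P_q`. As `r_b 1_b`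
lies in `K ∩ ℕ^A`, its column `b` is `P_q(r_b 1_b) / r_b`. -/
noncomputable def productionMatrix (N : AbelianNetwork G A Q) (q : ∀ v, Q v) :
    Matrix (Σ v, A v) (Σ v, A v) ℚ :=
  Matrix.of fun a b =>
    (N.production q (Pi.single b (N.resetNumber b)) a : ℚ) / (N.resetNumber b : ℚ)

variable [∀ v, Fintype (Q v)]

/-- The expected odometer `E[x.q]` for `q` uniformly distributed on the recurrent states. -/
noncomputable def expectedOdometer (N : AbelianNetwork G A Q) (h : N.HaltsOnAllInputs)
    (x : (Σ v, A v) → ℕ) : (Σ v, A v) → ℚ :=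
  fun a => (∑ q ∈ (Set.toFinite (N.Rec h)).toFinset, (N.odometer h x q a : ℚ)) /
    ((N.Rec h).ncard : ℚ)

end

end AbelianNetwork

/-!
The displacement of a word, the net change of the letters waiting when it is executed, is a cocycle
for the action of words on the locally recurrent states. Words permute these states, so the mean of
the displacement over them is additive in the word. By irreducibility all locally recurrent states
are connected by words; since words commute, a word that fixes one of them has the same displacement
at all of them, which is then the mean one. Applied to the powers `b ^ r_b` of single letters, this
identifies the mean displacement of `w` as `(P - 1) |w|`; applied to loops at `q₀`, it shows that
the displacement of `w` at `q` is `(P - 1) |w| + φ (w • q) - φ q` for some function `φ`.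

A complete legal word for `x.q` has displacement `-x` and carries `q` to `x ▷▷ q`. Inputs permute
the recurrent states, all of which are locally recurrent because a recurrent state is fixed by an
input that contains every letter. So averaging over the recurrent states cancels `φ`, and leaves
`(1 - P) E[x.q] = x`. For `x = 1_b` this exhibits the columns of a right inverse of `1 - P`.
-/

open scoped BigOperators

/-! ### Recurrent elements of commutative actions -/

namespace IsRecurrentElt

variable {M X : Type*} [Monoid M] [MulAction M X] {x : X}

theorem exists_smul_eq (hx : IsRecurrentElt M x) (hirr : IsIrreducibleAction M X) (y : X) :
    ∃ m : M, m • y = x := by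
  obtain ⟨m, m', hm⟩ := hirr.2 y x
  obtain ⟨n, hn⟩ := hx m'
  exact ⟨n * m, by rw [mul_smul, hm, hn]⟩

theorem smul [SMulCommClass M M X] (hx : IsRecurrentElt M x) (m : M) :
    IsRecurrentElt M (m • x) := fun n => by
  obtain ⟨k, hk⟩ := hx n
  exact ⟨k, by rw [smul_comm n m, smul_comm k m, hk]⟩

end IsRecurrentElt

section CommutingAction

variable {M X : Type*} [Monoid M] [MulAction M X]

theorem bijOn_smul_isRecurrentElt [SMulCommClass M M X] [Finite X] (m : M) :
    Set.BijOn (m • ·) {x : X | IsRecurrentElt M x} {x | IsRecurrentElt M x} := by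
  refine ((Set.toFinite _).surjOn_iff_bijOn_of_mapsTo fun x hx => hx.smul m).1 fun x hx => ?_
  obtain ⟨n, hn⟩ := hx m
  exact ⟨n • x, hx.smul n, (smul_comm m n x).trans hn⟩

theorem exists_pow_smul_eq_self [SMulCommClass M M X] [Finite X] (m : M) :
    ∃ n, 0 < n ∧ ∀ x : X, IsRecurrentElt M x → m ^ n • x = x := by
  classical
  have := Fintype.ofFinite {x : X | IsRecurrentElt M x}
  have hm := bijOn_smul_isRecurrentElt (X := X) m
  have hid := Function.injective_iff_iterate_factorial_card_eq_id.1
    (hm.mapsTo.restrict_inj.2 hm.injOn)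
  refine ⟨(Fintype.card {x : X | IsRecurrentElt M x}).factorial, Nat.factorial_pos _,
    fun x hx => ?_⟩
  rw [← smul_iterate_apply]
  rw [hm.mapsTo.iterate_restrict] at hid
  exact congrArg Subtype.val (congrFun hid ⟨x, hx⟩)

theorem isRecurrentElt_of_closure_eq_top [SMulCommClass M M X] {s : Set M}
    (hs : Submonoid.closure s = ⊤) {x : X} (hx : ∀ a ∈ s, ∃ m : M, m • a • x = x) :
    IsRecurrentElt M x := by
  intro m
  have hm : m ∈ Submonoid.closure s := hs ▸ Submonoid.mem_top m
  induction hm using Submonoid.closure_induction with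
  | mem a ha => exact hx a ha
  | one => exact ⟨1, by simp only [one_smul]⟩
  | mul m n _ _ ihm ihn =>
    obtain ⟨m', hm⟩ := ihm
    obtain ⟨n', hn⟩ := ihn
    exact ⟨m' * n', by rw [mul_smul, mul_smul, smul_comm n' m, hn, hm]⟩

end CommutingAction

theorem isRecurrentElt_pi_iff {ι : Type*} {M X : ι → Type*} [∀ i, Monoid (M i)]
    [∀ i, MulAction (M i) (X i)] {x : ∀ i, X i} :
    IsRecurrentElt (∀ i, M i) x ↔ ∀ i, IsRecurrentElt (M i) (x i) := by
  classical
  constructor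
  · intro h i m
    obtain ⟨m', hm'⟩ := h (Pi.mulSingle i m)
    exact ⟨m' i, by simpa using congrFun hm' i⟩
  · intro h m
    choose m' hm' using fun i => h i (m i)
    exact ⟨m', funext hm'⟩

theorem IsIrreducibleAction.pi {ι : Type*} {M X : ι → Type*} [∀ i, Monoid (M i)]
    [∀ i, MulAction (M i) (X i)] (h : ∀ i, IsIrreducibleAction (M i) (X i)) :
    IsIrreducibleAction (∀ i, M i) (∀ i, X i) := by
  have := fun i => (h i).1
  refine ⟨inferInstance, fun x x' => ?_⟩
  choose m m' hm using fun i => (h i).2 (x i) (x' i)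
  exact ⟨m, m', funext hm⟩

theorem expect_comp_of_bijOn {X E : Type*} [AddCommMonoid E] [Module ℚ≥0 E] {s : Set X}
    (hs : s.Finite) {f : X → X} (hf : Set.BijOn f s s) (g : X → E) :
    𝔼 x ∈ hs.toFinset, g (f x) = 𝔼 x ∈ hs.toFinset, g x := by
  rw [← hs.coe_toFinset] at hf
  exact Finset.expect_nbij f hf.mapsTo (fun _ _ => rfl) hf.injOn hf.surjOn

theorem mulVec_expect {ι m n : Type*} [Fintype n] (M : Matrix m n ℚ) (s : Finset ι)
    (f : ι → n → ℚ) : M.mulVec (𝔼 i ∈ s, f i) = 𝔼 i ∈ s, M.mulVec (f i) :=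
  map_expect (M.mulVecLin.restrictScalars ℚ≥0) f s

theorem pi_mulSingle_smul {ι : Type*} [DecidableEq ι] {M X : ι → Type*} [∀ i, Monoid (M i)]
    [∀ i, MulAction (M i) (X i)] (i : ι) (m : M i) (x : ∀ i, X i) :
    (Pi.mulSingle i m : ∀ i, M i) • x = Function.update x i (m • x i) := by
  funext j
  rcases eq_or_ne j i with rfl | hj
  · rw [Pi.smul_apply', Pi.mulSingle_eq_same, Function.update_self]
  · rw [Pi.smul_apply', Pi.mulSingle_eq_of_ne hj, one_smul, Function.update_of_ne hj]

/-! ### Processors -/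

namespace AbelianProcessor

variable {I S U : Type*} {B : U → Type*} (p : AbelianProcessor I S B)

/-- The transition map `t_a` as an element of the transition monoid. -/
def letter (a : I) : p.transitionMonoid :=
  ⟨p.t a, Submonoid.subset_closure ⟨a, rfl⟩⟩

instance : IsMulCommutative p.transitionMonoid :=
  Submonoid.isMulCommutative_closure _ <| by
    rintro _ ⟨a, rfl⟩ _ ⟨b, rfl⟩
    exact p.t_comm a b

open scoped IsMulCommutative in
instance : SMulCommClass p.transitionMonoid p.transitionMonoid S :=
  smulCommClass_self _ _

theorem closure_range_letter : Submonoid.closure (Set.range p.letter) = ⊤ := by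
  refine Eq.trans ?_ (Submonoid.closure_closure_coe_preimage (s := Set.range p.t))
  congr 1
  ext m
  exact exists_congr fun a => Subtype.ext_iff

open scoped IsMulCommutative in
theorem prod_map_letter_perm {w w' : List I} (h : w.Perm w') :
    (w.map p.letter).prod = (w'.map p.letter).prod :=
  (h.map p.letter).prod_eq

theorem runWord_eq_smul (q : S) (w : List I) : runWord p.t q w = (w.map p.letter).prod • q := by
  induction w generalizing q with
  | nil => exact (one_smul p.transitionMonoid q).symm
  | cons a w ih =>
    rw [List.map_cons, List.prod_cons, mul_smul, smul_comm]
    exact ih (p.t a q)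

variable [DecidableEq I]

theorem zero_mem_kernel : 0 ∈ p.kernel := fun w w' hw q _ => by
  have hperm : w.Perm w' := List.perm_iff_count.2 fun a => by
    have := hw a
    rw [Pi.zero_apply] at this
    omega
  rw [runWord_eq_smul, runWord_eq_smul, p.prod_map_letter_perm hperm]

theorem single_mem_kernel_iff {a : I} {n : ℕ} :
    (Pi.single a (n : ℤ) : I → ℤ) ∈ p.kernel ↔
      ∀ q : S, IsRecurrentElt p.transitionMonoid q → p.letter a ^ n • q = q := by
  constructor
  · intro h q hq
    have := h (List.replicate n a) [] (fun b => ?_) q hq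
    · rw [runWord_eq_smul, List.map_replicate, List.prod_replicate] at this
      exact this
    · simp [List.count_replicate, Pi.single_apply, eq_comm (a := b)]
  · intro h w w' hw q hq
    have hperm : w.Perm (List.replicate n a ++ w') := List.perm_iff_count.2 fun b => by
      have := hw b
      rw [Pi.single_apply] at this
      simp only [List.count_append, List.count_replicate, beq_iff_eq, eq_comm (a := a)]
      split_ifs at this ⊢ <;> omega
    rw [runWord_eq_smul, runWord_eq_smul, p.prod_map_letter_perm hperm, List.map_append,
      List.prod_append, mul_smul, List.map_replicate, List.prod_replicate, h _ (hq.smul _)]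

end AbelianProcessor

namespace AbelianNetwork

/-! ### The local action and the displacement -/

section Local

variable {V : Type*} {G : Digraph V} {A Q : V → Type*} (N : AbelianNetwork G A Q)

/-- The product of the local monoids, acting on the total state space: the monoid of
transformations of the states by words, regardless of the letters passed. -/
abbrev LocalMonoid : Type _ := ∀ v, (N.proc v).transitionMonoid

variable {N} in
theorem locallyRecurrent_iff {q : ∀ v, Q v} :
    N.LocallyRecurrent q ↔ IsRecurrentElt N.LocalMonoid q :=
  isRecurrentElt_pi_iff.symm

variable [DecidableEq V]

/-- The letter `a` as an element of the local monoid. -/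
def letter (a : Σ v, A v) : N.LocalMonoid :=
  Pi.mulSingle a.1 ((N.proc a.1).letter a.2)

/-- The element of the local monoid by which a word acts. -/
def wordAction (w : List (Σ v, A v)) : N.LocalMonoid :=
  (w.map N.letter).prod

theorem closure_range_letter [Finite V] : Submonoid.closure (Set.range N.letter) = ⊤ := by
  have hrange : Set.range N.letter = ⋃ v, MonoidHom.mulSingle
      (fun v => (N.proc v).transitionMonoid) v '' Set.range (N.proc v).letter := by
    ext m
    simp only [Set.mem_iUnion, Set.mem_image, Set.mem_range, Sigma.exists, exists_exists_eq_and]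
    rfl
  rw [hrange, Submonoid.closure_iUnion]
  simp only [← MonoidHom.map_mclosure, AbelianProcessor.closure_range_letter]
  rw [Submonoid.iSup_map_mulSingle, Submonoid.pi_top]

theorem wordAction_surjective [Finite V] : Function.Surjective N.wordAction := fun m => by
  have hm : m ∈ MonoidHom.mrange (FreeMonoid.lift N.letter) := by
    rw [FreeMonoid.mrange_lift, N.closure_range_letter]
    exact Submonoid.mem_top m
  obtain ⟨w, rfl⟩ := hm
  exact ⟨w.toList, (FreeMonoid.lift_apply _ _).symm⟩

theorem wordAction_append_smul (w w' : List (Σ v, A v)) (q : ∀ v, Q v) :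
    N.wordAction (w ++ w') • q = N.wordAction w' • N.wordAction w • q := by
  rw [smul_comm, wordAction, List.map_append, List.prod_append, mul_smul]
  rfl

open scoped IsMulCommutative in
theorem wordAction_perm {w w' : List (Σ v, A v)} (h : w.Perm w') :
    N.wordAction w = N.wordAction w' :=
  (h.map N.letter).prod_eq

theorem wordAction_singleton (a : Σ v, A v) : N.wordAction [a] = N.letter a := by
  rw [wordAction, List.map_singleton, List.prod_singleton]

theorem wordAction_replicate (n : ℕ) (a : Σ v, A v) :
    N.wordAction (List.replicate n a) = N.letter a ^ n := by
  rw [wordAction, List.map_replicate, List.prod_replicate]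

theorem exists_wordAction_smul_eq [Finite V] (hirr : N.Irreducible) (q : ∀ v, Q v)
    {q' : ∀ v, Q v} (hq' : N.LocallyRecurrent q') : ∃ w, N.wordAction w • q = q' := by
  obtain ⟨m, hm⟩ := (locallyRecurrent_iff.1 hq').exists_smul_eq (.pi hirr) q
  obtain ⟨w, rfl⟩ := N.wordAction_surjective m
  exact ⟨w, hm⟩

theorem bijOn_wordAction_smul [Finite V] [∀ v, Finite (Q v)] (w : List (Σ v, A v)) :
    Set.BijOn (N.wordAction w • ·) {q | N.LocallyRecurrent q} {q | N.LocallyRecurrent q} := by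
  simpa only [locallyRecurrent_iff] using bijOn_smul_isRecurrentElt (N.wordAction w)

variable [∀ v, DecidableEq (A v)]

/-- The net change in the letters waiting to be processed when the word `w` is executed in
state `q`. -/
noncomputable def displacement (w : List (Σ v, A v)) (q : ∀ v, Q v) : (Σ v, A v) → ℤ :=
  (N.exec w (0, q)).1

theorem step_eq (a : Σ v, A v) (c : Config A Q) :
    N.step a c = (c.1 + N.displacement [a] c.2, N.letter a • c.2) := by
  refine Prod.ext (funext fun b => ?_) ?_
  · simp only [step, displacement, exec, Pi.add_apply, Pi.zero_apply]
    ring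
  · rw [letter, pi_mulSingle_smul]
    rfl

theorem exec_eq (w : List (Σ v, A v)) (c : Config A Q) :
    N.exec w c = (c.1 + N.displacement w c.2, N.wordAction w • c.2) := by
  suffices ∀ q y z, N.exec w (y + z, q) = (y + (N.exec w (z, q)).1, N.wordAction w • q) by
    simpa only [displacement, add_zero] using this c.2 c.1 0
  induction w with
  | nil => exact fun q y z => Prod.ext rfl (one_smul N.LocalMonoid q).symm
  | cons a w ih =>
    intro q y z
    rw [exec, exec, step_eq, step_eq, add_assoc, ih, ← smul_comm, ← mul_smul]
    rfl

theorem exec_append (w w' : List (Σ v, A v)) (c : Config A Q) :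
    N.exec (w ++ w') c = N.exec w' (N.exec w c) := by
  induction w generalizing c with
  | nil => rfl
  | cons _ _ ih => exact ih _

theorem displacement_append (w w' : List (Σ v, A v)) (q : ∀ v, Q v) :
    N.displacement (w ++ w') q = N.displacement w q + N.displacement w' (N.wordAction w • q) := by
  rw [displacement, exec_append, exec_eq, exec_eq, zero_add]

theorem displacement_perm {w w' : List (Σ v, A v)} (h : w.Perm w') (q : ∀ v, Q v) :
    N.displacement w q = N.displacement w' q := by
  rw [displacement, displacement, N.exec_perm h]

theorem displacement_wordAction_smul {w : List (Σ v, A v)} {q : ∀ v, Q v}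
    (hw : N.wordAction w • q = q) (u : List (Σ v, A v)) :
    N.displacement w (N.wordAction u • q) = N.displacement w q := by
  have h := N.displacement_perm (List.perm_append_comm (l₁ := u) (l₂ := w)) q
  rw [displacement_append, displacement_append, hw, add_comm] at h
  exact add_right_cancel h

/-! ### The mean displacement -/

/-- The displacement of the word `w`, averaged over all locally recurrent states. -/
noncomputable def meanDisplacement [Finite V] [∀ v, Finite (Q v)] (w : List (Σ v, A v)) :
    (Σ v, A v) → ℚ :=
  fun a => 𝔼 q ∈ (Set.toFinite {q | N.LocallyRecurrent q}).toFinset, (N.displacement w q a : ℚ)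

section

variable [Finite V] [∀ v, Finite (Q v)]

theorem meanDisplacement_nil : N.meanDisplacement [] = 0 :=
  funext fun a => by
    simp only [meanDisplacement, displacement, exec, Pi.zero_apply, Int.cast_zero,
      Finset.expect_const_zero]

theorem meanDisplacement_append (w w' : List (Σ v, A v)) :
    N.meanDisplacement (w ++ w') = N.meanDisplacement w + N.meanDisplacement w' :=
  funext fun a => by
    simp only [meanDisplacement, displacement_append, Pi.add_apply, Int.cast_add,
      Finset.expect_add_distrib]
    rw [expect_comp_of_bijOn (Set.toFinite _) (N.bijOn_wordAction_smul w)
      fun q => (N.displacement w' q a : ℚ)]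

theorem meanDisplacement_cons (b : Σ v, A v) (w : List (Σ v, A v)) :
    N.meanDisplacement (b :: w) = N.meanDisplacement [b] + N.meanDisplacement w :=
  N.meanDisplacement_append [b] w

theorem meanDisplacement_replicate (n : ℕ) (b : Σ v, A v) :
    N.meanDisplacement (List.replicate n b) = n • N.meanDisplacement [b] := by
  induction n with
  | zero => rw [List.replicate_zero, meanDisplacement_nil, zero_nsmul]
  | succ n ih => rw [List.replicate_succ, meanDisplacement_cons, ih, succ_nsmul']

variable (hirr : N.Irreducible) {q₀ : ∀ v, Q v} (hq₀ : N.LocallyRecurrent q₀)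
include hirr hq₀

theorem displacement_eq_meanDisplacement {w : List (Σ v, A v)} (hw : N.wordAction w • q₀ = q₀)
    (a : Σ v, A v) : (N.displacement w q₀ a : ℚ) = N.meanDisplacement w a := by
  have hconst : ∀ q ∈ (Set.toFinite {q | N.LocallyRecurrent q}).toFinset,
      (N.displacement w q a : ℚ) = N.displacement w q₀ a := fun q hq => by
    obtain ⟨u, rfl⟩ := N.exists_wordAction_smul_eq hirr q₀ ((Set.Finite.mem_toFinset _).1 hq)
    rw [N.displacement_wordAction_smul hw]
  rw [meanDisplacement, Finset.expect_congr rfl hconst,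
    Finset.expect_const ⟨q₀, (Set.Finite.mem_toFinset _).2 hq₀⟩]

theorem exists_displacement_eq_meanDisplacement_add_coboundary :
    ∃ φ : (∀ v, Q v) → (Σ v, A v) → ℚ, ∀ q, N.LocallyRecurrent q → ∀ w a,
      (N.displacement w q a : ℚ) =
        N.meanDisplacement w a + (φ (N.wordAction w • q) a - φ q a) := by
  have hpath : ∀ q, ∃ u, N.LocallyRecurrent q → N.wordAction u • q₀ = q := fun q => by
    by_cases hq : N.LocallyRecurrent q
    · obtain ⟨u, hu⟩ := N.exists_wordAction_smul_eq hirr q₀ hq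
      exact ⟨u, fun _ => hu⟩
    · exact ⟨[], fun h => absurd h hq⟩
  choose u hu using hpath
  refine ⟨fun q a => N.displacement (u q) q₀ a - N.meanDisplacement (u q) a, fun q hq w a => ?_⟩
  have hwq : N.LocallyRecurrent (N.wordAction w • q) := (N.bijOn_wordAction_smul w).mapsTo hq
  obtain ⟨z, hz⟩ := N.exists_wordAction_smul_eq hirr (N.wordAction w • q) hq₀
  -- Compare the loops at `q₀` which reach `w • q` through `q` and directly, and return by `z`.
  have hthrough := N.displacement_eq_meanDisplacement hirr hq₀ (w := u q ++ (w ++ z))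
    (by rw [wordAction_append_smul, wordAction_append_smul, hu q hq, hz]) a
  have hdirect := N.displacement_eq_meanDisplacement hirr hq₀ (w := u (N.wordAction w • q) ++ z)
    (by rw [wordAction_append_smul, hu _ hwq, hz]) a
  simp only [displacement_append, meanDisplacement_append, Pi.add_apply, Int.cast_add, hu q hq,
    hu _ hwq] at hthrough hdirect
  linarith

end

/-! ### The production matrix -/

theorem single_mem_totalKernel_iff {b : Σ v, A v} {n : ℤ} :
    (Pi.single b n : (Σ v, A v) → ℤ) ∈ N.totalKernel ↔
      (Pi.single b.2 n : A b.1 → ℤ) ∈ (N.proc b.1).kernel := by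
  have hsame : (fun a => (Pi.single b n : (Σ v, A v) → ℤ) ⟨b.1, a⟩) = Pi.single b.2 n := by
    funext a
    obtain ⟨v, b⟩ := b
    simp [Pi.single_apply]
  refine ⟨fun h => hsame ▸ h b.1, fun h v => ?_⟩
  rcases eq_or_ne v b.1 with rfl | hv
  · exact hsame ▸ h
  · convert (N.proc v).zero_mem_kernel
    exact Pi.single_eq_of_ne (fun h => hv (congrArg Sigma.fst h)) _

theorem resetNumber_spec [∀ v, Finite (Q v)] (b : Σ v, A v) :
    0 < N.resetNumber b ∧ ∀ q : Q b.1, IsRecurrentElt (N.proc b.1).transitionMonoid q →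
      (N.proc b.1).letter b.2 ^ N.resetNumber b • q = q := by
  obtain ⟨n, hn, hfix⟩ := exists_pow_smul_eq_self (X := Q b.1) ((N.proc b.1).letter b.2)
  have hmem := Nat.sInf_mem (s := {m : ℕ | 1 ≤ m ∧ Pi.single b (m : ℤ) ∈ N.totalKernel})
    ⟨n, hn, N.single_mem_totalKernel_iff.2 ((N.proc b.1).single_mem_kernel_iff.2 hfix)⟩
  exact ⟨hmem.1, (N.proc b.1).single_mem_kernel_iff.1 (N.single_mem_totalKernel_iff.1 hmem.2)⟩

theorem letter_pow_resetNumber_smul [∀ v, Finite (Q v)] {q : ∀ v, Q v}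
    (hq : N.LocallyRecurrent q) (b : Σ v, A v) : N.letter b ^ N.resetNumber b • q = q := by
  rw [letter, ← Pi.mulSingle_pow, pi_mulSingle_smul, (N.resetNumber_spec b).2 _ (hq b.1),
    Function.update_eq_self]

theorem vecWord_single_perm [Fintype V] [∀ v, Fintype (A v)] (b : Σ v, A v) (n : ℕ) :
    (vecWord (Pi.single b n)).Perm (List.replicate n b) := by
  rw [← Multiset.coe_eq_coe, vecWord, Multiset.coe_toList,
    Finset.sum_eq_single b (fun a _ ha => by rw [Pi.single_eq_of_ne ha, zero_nsmul]) (by simp),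
    Pi.single_eq_same, Multiset.nsmul_singleton, Multiset.coe_replicate]

section

variable [Fintype V] [∀ v, Fintype (A v)] [∀ v, Finite (Q v)]

theorem displacement_replicate_resetNumber (b a : Σ v, A v) (q : ∀ v, Q v) :
    (N.displacement (List.replicate (N.resetNumber b) b) q a : ℚ) =
      N.resetNumber b * (N.productionMatrix q - 1) a b := by
  have hr : (N.resetNumber b : ℚ) ≠ 0 := Nat.cast_ne_zero.2 (N.resetNumber_spec b).1.ne'
  have hprod : N.production q (Pi.single b (N.resetNumber b)) a =
      (Pi.single b (N.resetNumber b) : (Σ v, A v) → ℕ) a +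
        N.displacement (List.replicate (N.resetNumber b) b) q a := by
    rw [production, localAction, exec_eq, N.displacement_perm (vecWord_single_perm b _)]
    simp only [Pi.add_apply, Pi.zero_apply, add_zero]
  rw [Matrix.sub_apply, productionMatrix, Matrix.of_apply, hprod, mul_sub, mul_div_cancel₀ _ hr,
    Pi.single_apply, Matrix.one_apply]
  split_ifs <;> simp

variable (hirr : N.Irreducible) {q : ∀ v, Q v} (hq : N.LocallyRecurrent q)
include hirr hq

theorem meanDisplacement_singleton (b : Σ v, A v) :
    N.meanDisplacement [b] = (N.productionMatrix q - 1).col b := by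
  funext a
  have hr : (N.resetNumber b : ℚ) ≠ 0 := Nat.cast_ne_zero.2 (N.resetNumber_spec b).1.ne'
  refine mul_left_cancel₀ hr ?_
  rw [Matrix.col_apply, ← N.displacement_replicate_resetNumber,
    N.displacement_eq_meanDisplacement hirr hq, meanDisplacement_replicate, Pi.smul_apply,
    nsmul_eq_mul]
  rw [wordAction_replicate, N.letter_pow_resetNumber_smul hq]

theorem meanDisplacement_eq_mulVec (w : List (Σ v, A v)) :
    N.meanDisplacement w = (N.productionMatrix q - 1).mulVec (fun a => (wordVec w a : ℚ)) := by
  induction w with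
  | nil =>
    simp only [wordVec, List.count_nil, Nat.cast_zero, meanDisplacement_nil]
    exact (Matrix.mulVec_zero _).symm
  | cons b w ih =>
    have hcons : (fun a => (wordVec (b :: w) a : ℚ)) =
        (fun a => (wordVec w a : ℚ)) + Pi.single b 1 := by
      funext a
      simp [wordVec, List.count_cons, Pi.single_apply, eq_comm (a := a)]
    rw [hcons, Matrix.mulVec_add, Matrix.mulVec_single_one, meanDisplacement_cons,
      N.meanDisplacement_singleton hirr hq, ih, add_comm]

end

end Local

/-! ### The global action -/

section Global

variable {V : Type*} {G : Digraph V} {A Q : V → Type*} [DecidableEq V] [∀ v, DecidableEq (A v)]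
  (N : AbelianNetwork G A Q)

namespace Legal

variable {N} {w w' : List (Σ v, A v)} {c : Config A Q}

theorem exec_nonneg (hw : N.Legal w c) (hc : 0 ≤ c.1) : 0 ≤ (N.exec w c).1 := by
  induction w generalizing c with
  | nil => exact hc
  | cons b w ih =>
    refine ih hw.2 fun d => ?_
    have hb := hw.1
    have hd : 0 ≤ c.1 d := hc d
    simp only [step, Pi.zero_apply]
    split_ifs with hdb
    · subst hdb
      omega
    · omega

theorem append (hw : N.Legal w c) (hw' : N.Legal w' (N.exec w c)) : N.Legal (w ++ w') c := by
  induction w generalizing c with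
  | nil => exact hw'
  | cons b w ih => exact ⟨hw.1, ih hw.2 hw'⟩

theorem add (hw : N.Legal w c) {y : (Σ v, A v) → ℤ} (hy : 0 ≤ y) :
    N.Legal w (y + c.1, c.2) := by
  induction w generalizing c with
  | nil => trivial
  | cons b w ih =>
    have hstep : N.step b (y + c.1, c.2) = (y + (N.step b c).1, (N.step b c).2) := by
      rw [step_eq, step_eq, add_assoc]
    exact ⟨le_add_of_nonneg_of_le (hy b) hw.1, hstep ▸ ih hw.2⟩

end Legal

variable (h : N.HaltsOnAllInputs)

theorem exec_haltingWord (x : (Σ v, A v) → ℕ) (q : ∀ v, Q v) :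
    N.exec (N.haltingWord h x q) (config x q) = (0, N.finalState h x q) := by
  obtain ⟨hlegal, hcomplete⟩ := Classical.choose_spec (h x q)
  exact Prod.ext (le_antisymm hcomplete (hlegal.exec_nonneg fun a => Int.natCast_nonneg _)) rfl

theorem wordAction_haltingWord_smul (x : (Σ v, A v) → ℕ) (q : ∀ v, Q v) :
    N.wordAction (N.haltingWord h x q) • q = N.finalState h x q := by
  have hexec := congrArg Prod.snd (N.exec_haltingWord h x q)
  rwa [exec_eq] at hexec

theorem displacement_haltingWord (x : (Σ v, A v) → ℕ) (q : ∀ v, Q v) (a : Σ v, A v) :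
    N.displacement (N.haltingWord h x q) q a = -(x a : ℤ) := by
  have hexec := congrArg Prod.fst (N.exec_haltingWord h x q)
  rw [exec_eq] at hexec
  exact eq_neg_of_add_eq_zero_right (congrFun hexec a)

theorem mem_haltingWord {x : (Σ v, A v) → ℕ} {a : Σ v, A v} (ha : 1 ≤ x a) (q : ∀ v, Q v) :
    a ∈ N.haltingWord h x q := by
  by_contra hn
  have hle := N.le_exec_of_notMem a _ hn (config x q)
  rw [exec_haltingWord] at hle
  simp only [config, Pi.zero_apply] at hle
  omega

theorem finalState_zero (q : ∀ v, Q v) : N.finalState h 0 q = q :=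
  (N.odometer_finalState_eq h 0 q [] trivial fun _ => le_rfl).2

theorem finalState_add (x y : (Σ v, A v) → ℕ) (q : ∀ v, Q v) :
    N.finalState h (x + y) q = N.finalState h y (N.finalState h x q) := by
  set w := N.haltingWord h x q
  set w' := N.haltingWord h y (N.finalState h x q)
  have hw : N.Legal w (config x q) := (Classical.choose_spec (h x q)).1
  have hw' : N.Legal w' (config y _) := (Classical.choose_spec (h y (N.finalState h x q))).1
  have hexec : N.exec w (config (x + y) q) = config y (N.finalState h x q) := by
    rw [exec_eq]
    refine Prod.ext (funext fun a => ?_) (N.wordAction_haltingWord_smul h x q)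
    simp [config, w, displacement_haltingWord]
  have hlegal : N.Legal (w ++ w') (config (x + y) q) := by
    refine Legal.append ?_ (hexec ▸ hw')
    have hconfig : config (x + y) q = ((fun a => (y a : ℤ)) + (config x q : Config A Q).1, q) :=
      Prod.ext (funext fun a => by simp [config, add_comm]) rfl
    exact hconfig ▸ hw.add fun a => Int.natCast_nonneg _
  have hhalt : N.exec (w ++ w') (config (x + y) q) =
      (0, N.finalState h y (N.finalState h x q)) := by
    rw [exec_append, hexec, exec_haltingWord]
  rw [(N.odometer_finalState_eq h _ q _ hlegal fun a => by rw [hhalt]; rfl).2, hhalt]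

/-- The action `x ↦ (q ↦ x ▷▷ q)` of `ℕ^A` on the total state space. -/
noncomputable def inputAction :
    Multiplicative ((Σ v, A v) → ℕ) →* Function.End (∀ v, Q v) where
  toFun x := N.finalState h x.toAdd
  map_one' := funext (N.finalState_zero h)
  map_mul' x y := funext fun q => by
    rw [mul_comm x y]
    exact N.finalState_add h y.toAdd x.toAdd q

theorem globalMonoid_eq_mrange [Finite V] [∀ v, Finite (A v)] :
    N.globalMonoid h = MonoidHom.mrange (N.inputAction h) := by
  classical
  refine le_antisymm (Submonoid.closure_le.2 ?_) ?_
  · rintro _ ⟨a, rfl⟩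
    exact ⟨.ofAdd (Pi.single a 1), rfl⟩
  rintro _ ⟨x, rfl⟩
  obtain ⟨x, rfl⟩ := Multiplicative.ofAdd.surjective x
  induction x using Pi.single_induction with
  | zero =>
    rw [ofAdd_zero, map_one]
    exact (N.globalMonoid h).one_mem
  | add x y hx hy =>
    rw [ofAdd_add, map_mul]
    exact mul_mem hx hy
  | single a k =>
    rw [← mul_one k, ← smul_eq_mul, Pi.single_smul, ofAdd_nsmul, map_pow]
    exact (N.globalMonoid h).pow_mem (Submonoid.subset_closure ⟨a, rfl⟩) k

instance : IsMulCommutative (N.globalMonoid h) :=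
  Submonoid.isMulCommutative_closure _ <| by
    rintro _ ⟨a, rfl⟩ _ ⟨b, rfl⟩
    exact ((Commute.all (Multiplicative.ofAdd (Pi.single a 1)) (.ofAdd (Pi.single b 1))).map
      (N.inputAction h)).eq

open scoped IsMulCommutative in
instance : SMulCommClass (N.globalMonoid h) (N.globalMonoid h) (∀ v, Q v) :=
  smulCommClass_self _ _

theorem bijOn_finalState [Finite V] [∀ v, Finite (A v)] [∀ v, Finite (Q v)]
    (x : (Σ v, A v) → ℕ) : Set.BijOn (N.finalState h x) (N.Rec h) (N.Rec h) := by
  have hx : (N.inputAction h (.ofAdd x)) ∈ N.globalMonoid h := by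
    rw [globalMonoid_eq_mrange]
    exact ⟨_, rfl⟩
  exact bijOn_smul_isRecurrentElt (⟨_, hx⟩ : N.globalMonoid h)

theorem exists_one_le_finalState_eq [Finite V] [∀ v, Finite (A v)] {q : ∀ v, Q v}
    (hq : q ∈ N.Rec h) : ∃ x, 1 ≤ x ∧ N.finalState h x q = q := by
  have hone : (N.inputAction h (.ofAdd 1)) ∈ N.globalMonoid h := by
    rw [globalMonoid_eq_mrange]
    exact ⟨_, rfl⟩
  obtain ⟨⟨m, hm⟩, hmq⟩ := hq ⟨_, hone⟩
  rw [globalMonoid_eq_mrange] at hm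
  obtain ⟨y, rfl⟩ := hm
  refine ⟨1 + y.toAdd, le_self_add, ?_⟩
  rw [finalState_add]
  exact hmq

theorem locallyRecurrent_of_mem_rec [Finite V] [∀ v, Finite (A v)] {q : ∀ v, Q v}
    (hq : q ∈ N.Rec h) : N.LocallyRecurrent q := by
  obtain ⟨x, hx, hfix⟩ := N.exists_one_le_finalState_eq h hq
  rw [← wordAction_haltingWord_smul] at hfix
  refine locallyRecurrent_iff.2 (isRecurrentElt_of_closure_eq_top N.closure_range_letter ?_)
  rintro _ ⟨a, rfl⟩
  refine ⟨N.wordAction ((N.haltingWord h x q).erase a), ?_⟩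
  rwa [N.wordAction_perm (List.perm_cons_erase (N.mem_haltingWord h (hx a) q)),
    ← List.singleton_append, wordAction_append_smul, wordAction_singleton] at hfix

theorem rec_nonempty [∀ v, Finite (Q v)] [Finite V] (hirr : N.Irreducible) :
    (N.Rec h).Nonempty :=
  have := fun v => (hirr v).1
  exists_isRecurrentElt (N.globalMonoid h) (∀ v, Q v)

theorem expectedOdometer_eq_expect [Fintype V] [∀ v, Fintype (Q v)]
    (x : (Σ v, A v) → ℕ) :
    N.expectedOdometer h x =
      𝔼 q ∈ (Set.toFinite (N.Rec h)).toFinset, fun a => (N.odometer h x q a : ℚ) := by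
  funext a
  rw [expectedOdometer, Finset.expect_apply, Finset.expect_eq_sum_div_card,
    Set.ncard_eq_toFinset_card _ (Set.toFinite _)]

variable [Fintype V] [∀ v, Fintype (A v)] (hirr : N.Irreducible) {q₀ : ∀ v, Q v}
  (hq₀ : N.LocallyRecurrent q₀)
include hirr hq₀

theorem mulVec_expectedOdometer [∀ v, Fintype (Q v)] (x : (Σ v, A v) → ℕ) :
    (1 - N.productionMatrix q₀).mulVec (N.expectedOdometer h x) = fun a => (x a : ℚ) := by
  obtain ⟨φ, hφ⟩ := N.exists_displacement_eq_meanDisplacement_add_coboundary hirr hq₀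
  have hne : (Set.toFinite (N.Rec h)).toFinset.Nonempty :=
    (Set.Finite.toFinset_nonempty _).2 (N.rec_nonempty h hirr)
  have hodometer : ∀ a, ∀ q ∈ (Set.toFinite (N.Rec h)).toFinset,
      (1 - N.productionMatrix q₀).mulVec (fun b => (N.odometer h x q b : ℚ)) a =
        x a + (φ (N.finalState h x q) a - φ q a) := fun a q hq => by
    have hlr := N.locallyRecurrent_of_mem_rec h ((Set.Finite.mem_toFinset _).1 hq)
    have hword := hφ q hlr (N.haltingWord h x q) a
    rw [displacement_haltingWord, wordAction_haltingWord_smul,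
      N.meanDisplacement_eq_mulVec hirr hq₀, Int.cast_neg, Int.cast_natCast] at hword
    rw [← neg_sub, Matrix.neg_mulVec, Pi.neg_apply]
    change -(Matrix.mulVec _ fun b => (wordVec (N.haltingWord h x q) b : ℚ)) a = _
    linarith
  funext a
  rw [expectedOdometer_eq_expect, mulVec_expect, Finset.expect_apply,
    Finset.expect_congr rfl (hodometer a), Finset.expect_add_distrib, Finset.expect_const hne,
    Finset.expect_sub_distrib,
    expect_comp_of_bijOn (Set.toFinite _) (N.bijOn_finalState h x) fun q => φ q a,
    sub_self, add_zero]

theorem isUnit_one_sub_productionMatrix [∀ v, Finite (Q v)] (h : N.HaltsOnAllInputs) :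
    IsUnit (1 - N.productionMatrix q₀) := by
  have := fun v => Fintype.ofFinite (Q v)
  refine .of_mul_eq_one (Matrix.of fun a b => N.expectedOdometer h (Pi.single b 1) a) ?_
  ext a b
  refine (congrFun (N.mulVec_expectedOdometer h hirr hq₀ (Pi.single b 1)) a).trans ?_
  rw [Pi.single_apply, Matrix.one_apply, Nat.cast_ite, Nat.cast_one, Nat.cast_zero]

end Global

end AbelianNetwork

theorem theorem3p7 {V : Type*} [Fintype V] [DecidableEq V] {G : Digraph V}
    {A Q : V → Type*} [∀ v, Fintype (A v)] [∀ v, DecidableEq (A v)] [∀ v, Fintype (Q v)]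
    (N : AbelianNetwork G A Q) (hirr : N.Irreducible) (hhalt : N.HaltsOnAllInputs) :
    (N.Rec hhalt).Nonempty ∧ (∃ q₀, N.LocallyRecurrent q₀) ∧
      ∀ q₀, N.LocallyRecurrent q₀ →
        IsUnit (1 - N.productionMatrix q₀) ∧
        ∀ x : (Σ v, A v) → ℕ,
          N.expectedOdometer hhalt x =
            (1 - N.productionMatrix q₀)⁻¹.mulVec (fun a => (x a : ℚ)) := by
  have hlr : ∃ q₀, N.LocallyRecurrent q₀ :=
    (N.rec_nonempty hhalt hirr).imp fun q => N.locallyRecurrent_of_mem_rec hhalt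
  refine ⟨N.rec_nonempty hhalt hirr, hlr, fun q₀ hq₀ => ?_⟩
  have hE := N.mulVec_expectedOdometer hhalt hirr hq₀
  have hunit := N.isUnit_one_sub_productionMatrix hirr hq₀ hhalt
  refine ⟨hunit, fun x => ?_⟩
  rw [← hE x, Matrix.mulVec_mulVec,
    Matrix.nonsing_inv_mul _ ((Matrix.isUnit_iff_isUnit_det _).1 hunit), Matrix.one_mulVec]
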